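/- A \emph{variety of monoids} is a class of monoids defined by a set of identities $\mathbf u\approx\mathbf v$, where $\mathbf u,\mathbf v$ are words in the free monoid over a countably infinite alphabet. Let $\mathbf{MON}$ be the lattice of all varieties of monoids, ordered by inclusion, and let $\mathbf{OC}$ be its sublattice of all \emph{overcommutative} varieties, i.e. of those containing every commutative monoid. A \emph{lattice identity} is a formal equality $s\approx t$ of two lattice terms; it is \emph{non-trivial} if it fails in some lattice. For a set $X$, let $\mathrm{Part}(X)$ be the lattice of all partitions (equivalently, equivalence relations) of $X$, ordered by refinement. An \emph{anti-homomorphism} of lattices is a map that sends joins to meets and meets to joins. \textbf{Theorem.} \begin{enumerate} \item For every integer $n\ge 0$ there are a sublattice $S$ of $\mathbf{OC}$ and a surjective lattice anti-homomorphism $S\to\mathrm{Part}(A_n)$, where $A_n=\{x^{n-i}yx^i : 0\le i\le n\}$ is a set of $n+1$ words over two distinct letters $x,y$. \item The lattice $\mathbf{OC}$ does not satisfy any non-trivial lattice identity. \item The lattice $\mathbf{MON}$ does not satisfy any non-trivial lattice identity. \end{enumerate} -/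

import Mathlib

universe u v

namespace MonVar

/-! ### Monoid varieties -/

/-- Words: elements of the free monoid over a countably infinite alphabet. -/
abbrev Word : Type := FreeMonoid ℕ

/-- A monoid identity `p.1 ≈ p.2` is a pair of words. -/
abbrev MonoidIdentity : Type := Word × Word

/-- The monoid `M` satisfies the identity `p.1 ≈ p.2`: both words take the same value under every
evaluation of the letters in `M`. -/
def Satisfies (M : Type u) [Monoid M] (p : MonoidIdentity) : Prop :=
  ∀ f : Word →* M, f p.1 = f p.2

/-- The class of all monoids satisfying every identity of the system `E`. -/
def models (E : Set MonoidIdentity) : Set MonCat.{u} :=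
  {M | ∀ p ∈ E, Satisfies M p}

/-- The set of all identities satisfied by every monoid of the class `K`. -/
def identitiesOf (K : Set MonCat.{u}) : Set MonoidIdentity :=
  {p | ∀ M ∈ K, Satisfies M p}

end MonVar

open MonVar in
/-- A variety of monoids: a class of monoids that is given by some system of identities. -/
def MonoidVariety : Type (u + 1) :=
  {K : Set MonCat.{u} // ∃ E : Set MonoidIdentity, K = models E}

namespace MonoidVariety

open MonVar

/-- Varieties are ordered by inclusion of classes. -/
instance : PartialOrder MonoidVariety.{u} :=
  inferInstanceAs (PartialOrder {K : Set MonCat.{u} // ∃ E : Set MonoidIdentity, K = models E})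

theorem le_iff {V W : MonoidVariety.{u}} : V ≤ W ↔ V.1 ⊆ W.1 := Iff.rfl

/-- The variety given by the identity system `E`. -/
def ofIdentities (E : Set MonoidIdentity) : MonoidVariety.{u} := ⟨models E, E, rfl⟩

theorem models_identitiesOf (V : MonoidVariety.{u}) : models (identitiesOf V.1) = V.1 := by
  obtain ⟨K, E, rfl⟩ := V
  apply Set.Subset.antisymm
  · intro M hM p hp
    exact hM p (fun N hN => hN p hp)
  · intro M hM p hp
    exact hp M hM

theorem inter_eq (V W : MonoidVariety.{u}) :
    V.1 ∩ W.1 = models (identitiesOf V.1 ∪ identitiesOf W.1) := by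
  conv_lhs => rw [← models_identitiesOf V, ← models_identitiesOf W]
  ext M
  exact ⟨fun h p hp => hp.elim (h.1 p) (h.2 p),
    fun h => ⟨fun p hp => h p (Or.inl hp), fun p hp => h p (Or.inr hp)⟩⟩

/-- The lattice of all monoid varieties. The meet of two varieties is their intersection, the join
is the smallest variety containing both, that is, the variety given by their common identities. -/
instance : Lattice MonoidVariety.{u} where
  inf V W := ⟨V.1 ∩ W.1, identitiesOf V.1 ∪ identitiesOf W.1, inter_eq V W⟩
  inf_le_left _ _ := Set.inter_subset_left
  inf_le_right _ _ := Set.inter_subset_right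
  le_inf _ _ _ := Set.subset_inter
  sup V W := ofIdentities (identitiesOf V.1 ∩ identitiesOf W.1)
  le_sup_left _ _ := fun M hM _ hp => hp.1 M hM
  le_sup_right _ _ := fun M hM _ hp => hp.2 M hM
  sup_le V W U hV hW := by
    rw [le_iff, ← models_identitiesOf U]
    exact fun M hM p hp => hM p ⟨fun N hN => hp N (hV hN), fun N hN => hp N (hW hN)⟩

/-- A variety is overcommutative if it contains all commutative monoids. -/
def IsOvercommutative (V : MonoidVariety.{u}) : Prop :=
  ∀ M : MonCat.{u}, (∀ a b : M, a * b = b * a) → M ∈ V.1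

end MonoidVariety

/-- The lattice of all monoid varieties. -/
abbrev MON : Type (u + 1) := MonoidVariety.{u}

/-- The lattice of all overcommutative monoid varieties, as a sublattice of `MON`. -/
def OC : Sublattice MON.{u} where
  carrier := {V | V.IsOvercommutative}
  supClosed' := fun V hV W _ M hM => (le_sup_left : V ≤ V ⊔ W) (hV M hM)
  infClosed' := fun _ hV _ hW M hM => ⟨hV M hM, hW M hM⟩

namespace MonVar

/-- The set `A_n` of the words `x ^ (n - i) y x ^ i` with `0 ≤ i ≤ n`, where `x`, `y` are two
distinct letters. -/
def wordsA (n : ℕ) : Set Word :=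
  {w | ∃ i : ℕ, i ≤ n ∧ w = FreeMonoid.of 0 ^ (n - i) * FreeMonoid.of 1 * FreeMonoid.of 0 ^ i}

end MonVar

/-! ### Lattice identities -/

/-- Lattice terms over countably many variables. -/
inductive LatticeTerm : Type
  | var : ℕ → LatticeTerm
  | meet : LatticeTerm → LatticeTerm → LatticeTerm
  | join : LatticeTerm → LatticeTerm → LatticeTerm

namespace LatticeTerm

/-- The value of a lattice term in the lattice `L` under an assignment of the variables. -/
def eval {L : Type v} [Lattice L] (a : ℕ → L) : LatticeTerm → L
  | var i => a i
  | meet s t => eval a s ⊓ eval a t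
  | join s t => eval a s ⊔ eval a t

end LatticeTerm

/-- A lattice identity `lhs ≈ rhs`. -/
structure LatticeIdentity : Type where
  lhs : LatticeTerm
  rhs : LatticeTerm

namespace LatticeIdentity

/-- The lattice `L` satisfies the identity `e`. -/
def HoldsIn (e : LatticeIdentity) (L : Type v) [Lattice L] : Prop :=
  ∀ a : ℕ → L, e.lhs.eval a = e.rhs.eval a

/-- An identity is non-trivial if it fails in some lattice. -/
def IsNontrivial (e : LatticeIdentity) : Prop :=
  ∃ (L : Type v) (_ : Lattice L), ¬ e.HoldsIn L

end LatticeIdentity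

/-!
The identities of a variety of monoids form a fully invariant congruence on the free monoid, and
intersecting varieties corresponds to joining congruences (`MonVar.identityCon_models_le`,
`MonoidVariety.toSetoid_identityCon_inf`). An overcommutative variety only satisfies identities
between words that are rearrangements of each other. As `wordsA n` is the set of all rearrangements
of `x ^ n y`, it is a union of classes of each such congruence, so restricting congruences to
`wordsA n` preserves joins as well as meets (`MonVar.comap_val_sup`). This gives the
anti-homomorphism `OC.partitionHom`, defined on the whole of `OC`.

It is surjective because a partition of `wordsA n`, read as a system of identities, implies nothing
new about `wordsA n`: by counting letters, a substitution instance of a word of `wordsA n` which is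
a factor of a word of `wordsA n` is trivial (`MonVar.factor_mem_wordsA_cases`). The only subtlety is
the interchange of the two letters for `n = 1`, which maps the identity `xy ≈ yx` to itself.

Consequently an identity of `OC` holds in the dual of every partition lattice of a finite non-empty
set. Such lattices satisfy no non-trivial identity. Indeed, let `s ≤ t` fail in a lattice `L` under
an assignment `a`. Following Jónsson, consider finite sets with an `L`-valued metric, and assign to
the variable `i` the relation "at distance at most `a i`". The value of `t` is then contained in
"at distance at most `t (a)`" (`LatticeMetric.eval_within_le`). Starting from two points at distance
`s (a)`, finitely many points may be added until the two points are related under the value of `s`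
(`LatticeMetric.exists_isometry_eval_within`): for a join, a path with alternating distances is
inserted (`LatticeMetric.jonsson`), and its steps are treated recursively. The two points now
witness that `s ≤ t` fails in a finite partition lattice.
-/

/-! ### Lattice terms, homomorphisms and duality -/

/-- A bijection induces an isomorphism of partition lattices. -/
def Setoid.comapOrderIso {X Y : Type*} (g : X ≃ Y) : Setoid Y ≃o Setoid X where
  toFun := Setoid.comap g
  invFun := Setoid.comap g.symm
  left_inv r := by rw [← Setoid.comap_comp]; simp
  right_inv r := by rw [← Setoid.comap_comp]; simp
  map_rel_iff' {r r'} := by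
    refine ⟨fun h x y hxy => ?_, fun h _ _ hxy => h hxy⟩
    have hr : r (g (g.symm x)) (g (g.symm y)) → r' (g (g.symm x)) (g (g.symm y)) := @h _ _
    simpa only [Equiv.apply_symm_apply, hxy, true_imp_iff] using hr

/-- An order isomorphism of lattices as a lattice homomorphism. -/
def OrderIso.toLatticeHom {L M : Type*} [Lattice L] [Lattice M] (f : L ≃o M) : LatticeHom L M where
  toFun := f
  map_sup' := f.map_sup
  map_inf' := f.map_inf

namespace LatticeTerm

theorem map_eval {L M : Type*} [Lattice L] [Lattice M] (f : LatticeHom L M) (a : ℕ → L)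
    (t : LatticeTerm) : f (t.eval a) = t.eval (fun i => f (a i)) := by
  induction t with
  | var i => rfl
  | meet s t hs ht => simp only [eval, map_inf, hs, ht]
  | join s t hs ht => simp only [eval, map_sup, hs, ht]

/-- The dual term, with meets and joins interchanged. -/
def dual : LatticeTerm → LatticeTerm
  | var i => var i
  | meet s t => join s.dual t.dual
  | join s t => meet s.dual t.dual

theorem dual_dual (t : LatticeTerm) : t.dual.dual = t := by
  induction t with
  | var i => rfl
  | meet s t hs ht => simp only [dual, hs, ht]
  | join s t hs ht => simp only [dual, hs, ht]

theorem eval_dual {L : Type*} [Lattice L] (a : ℕ → L) (t : LatticeTerm) :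
    t.dual.eval (fun i => OrderDual.toDual (a i)) = OrderDual.toDual (t.eval a) := by
  induction t with
  | var i => rfl
  | meet s t hs ht => simp only [dual, eval, hs, ht, toDual_inf]
  | join s t hs ht => simp only [dual, eval, hs, ht, toDual_sup]

end LatticeTerm

namespace LatticeIdentity

theorem HoldsIn.of_injective {L M : Type*} [Lattice L] [Lattice M] {e : LatticeIdentity}
    (h : e.HoldsIn M) (f : LatticeHom L M) (hf : Function.Injective f) : e.HoldsIn L := by
  intro a
  apply hf
  rw [LatticeTerm.map_eval, LatticeTerm.map_eval]
  exact h _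

theorem HoldsIn.of_surjective {L M : Type*} [Lattice L] [Lattice M] {e : LatticeIdentity}
    (h : e.HoldsIn L) (f : LatticeHom L M) (hf : Function.Surjective f) : e.HoldsIn M := by
  intro a
  choose b hb using fun i => hf (a i)
  have h' := congrArg f (h b)
  rw [LatticeTerm.map_eval, LatticeTerm.map_eval] at h'
  simpa only [hb] using h'

end LatticeIdentity

/-! ### Lattice-valued metrics and partition lattices -/

/-- A symmetric distance on `X` with values in the lattice `L`, where the join plays the role of
addition. Distinct points may have distance `⊥`. -/
structure LatticeMetric (L : Type*) [Lattice L] [OrderBot L] (X : Type*) where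
  dist : X → X → L
  dist_self : ∀ x, dist x x = ⊥
  dist_comm : ∀ x y, dist x y = dist y x
  dist_triangle : ∀ x y z, dist x z ≤ dist x y ⊔ dist y z

namespace LatticeMetric

variable {L : Type*} [Lattice L] [OrderBot L] {X Y : Type*}

/-- The equivalence relation of being at distance at most `a`. -/
def within (d : LatticeMetric L X) (a : L) : Setoid X where
  r x y := d.dist x y ≤ a
  iseqv :=
    { refl := fun x => (d.dist_self x).trans_le bot_le
      symm := fun h => (d.dist_comm _ _).trans_le h
      trans := fun h₁ h₂ => (d.dist_triangle _ _ _).trans (sup_le h₁ h₂) }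

theorem within_mono (d : LatticeMetric L X) {a b : L} (h : a ≤ b) : d.within a ≤ d.within b :=
  fun _ _ hxy => le_trans hxy h

/-- The map `within` preserves meets but, in general, joins only in one direction; so a term
evaluated at the relations `within` can only be too small. -/
theorem eval_within_le (d : LatticeMetric L X) (a : ℕ → L) (t : LatticeTerm) :
    t.eval (fun i => d.within (a i)) ≤ d.within (t.eval a) := by
  induction t with
  | var i => exact le_rfl
  | meet s t hs ht => exact fun _ _ h => le_inf (hs h.1) (ht h.2)
  | join s t hs ht =>
    exact sup_le (hs.trans (d.within_mono le_sup_left)) (ht.trans (d.within_mono le_sup_right))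

/-- Pairs related under the value of a term stay related in an extension of the metric. -/
theorem eval_within_of_isometry {d : LatticeMetric L X} {d' : LatticeMetric L Y} {f : X → Y}
    (hf : ∀ x y, d'.dist (f x) (f y) = d.dist x y) (a : ℕ → L) (t : LatticeTerm) :
    t.eval (fun i => d.within (a i)) ≤ Setoid.comap f (t.eval fun i => d'.within (a i)) := by
  induction t with
  | var i => exact fun _ _ h => (hf _ _).trans_le h
  | meet s t hs ht => exact fun _ _ h => ⟨hs h.1, ht h.2⟩
  | join s t hs ht =>
    exact sup_le (fun _ _ h => (le_sup_left : s.eval (fun i => d'.within (a i)) ≤ _) (hs h))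
      (fun _ _ h => (le_sup_right : t.eval (fun i => d'.within (a i)) ≤ _) (ht h))

/-- The distances between the three new points of a Jónsson extension. -/
def newDist (a b : L) : Fin 3 → Fin 3 → L :=
  ![![⊥, b, a ⊔ b], ![b, ⊥, a], ![a ⊔ b, a, ⊥]]

theorem newDist_triangle (a b : L) (i j k : Fin 3) :
    newDist a b i k ≤ newDist a b i j ⊔ newDist a b j k := by
  refine le_of_forall_ge fun c hc => ?_
  rw [sup_le_iff] at hc
  fin_cases i <;> fin_cases k <;> first
    | exact bot_le
    | fin_cases j <;> first
        | exact hc.1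
        | exact hc.2
        | exact sup_le hc.1 hc.2
        | exact sup_le hc.2 hc.1
        | exact (le_sup_left.trans hc.1)
        | exact (le_sup_right.trans hc.1)
        | exact (le_sup_left.trans hc.2)
        | exact (le_sup_right.trans hc.2)

/-- The distances from an old point `u` to the three new points of a Jónsson extension. -/
def mixedDist (d : LatticeMetric L X) (p q : X) (a b : L) (u : X) : Fin 3 → L :=
  ![d.dist u p ⊔ a, d.dist u p ⊔ (a ⊔ b), d.dist u q ⊔ b]

/-- The Jónsson extension: if `dist p q ≤ a ⊔ b`, three points `z₀, z₁, z₂` may be added such that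
the consecutive distances on the path `p, z₀, z₁, z₂, q` are `a, b, a, b`. -/
def jonsson (d : LatticeMetric L X) (p q : X) (a b : L) (h : d.dist p q ≤ a ⊔ b) :
    LatticeMetric L (X ⊕ Fin 3) where
  dist
    | .inl u, .inl v => d.dist u v
    | .inl u, .inr i => d.mixedDist p q a b u i
    | .inr i, .inl u => d.mixedDist p q a b u i
    | .inr i, .inr j => newDist a b i j
  dist_self := by
    rintro (u | i)
    · exact d.dist_self u
    · fin_cases i <;> rfl
  dist_comm := by
    rintro (u | i) (v | j)
    · exact d.dist_comm u v
    · rfl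
    · rfl
    · fin_cases i <;> fin_cases j <;> rfl
  dist_triangle := by
    -- An inequality `r ≤ s` is tested on the upper bounds `c` of `s`; this turns joins into
    -- conjunctions and leaves a propositional problem about the relations `dist _ _ ≤ c`.
    have htri : ∀ c x y z, d.dist x y ≤ c → d.dist y z ≤ c → d.dist x z ≤ c :=
      fun c x y z h₁ h₂ => (d.dist_triangle x y z).trans (sup_le h₁ h₂)
    have hsymm : ∀ c x y, d.dist x y ≤ c → d.dist y x ≤ c :=
      fun c x y h₁ => (d.dist_comm y x).trans_le h₁
    have hpq : ∀ c, a ≤ c → b ≤ c → d.dist p q ≤ c := fun c h₁ h₂ => h.trans (sup_le h₁ h₂)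
    clear h
    rintro (u | i) (v | j) (w | k) <;> refine le_of_forall_ge fun c hc => ?_
    · simp only [sup_le_iff] at hc
      exact htri c u v w hc.1 hc.2
    · fin_cases k <;> simp only [mixedDist, sup_le_iff, Fin.reduceFinMk, Fin.zero_eta,
        Fin.mk_one, Matrix.cons_val] at hc ⊢ <;> grind
    · fin_cases j <;> simp only [mixedDist, sup_le_iff, Fin.reduceFinMk, Fin.zero_eta,
        Fin.mk_one, Matrix.cons_val] at hc ⊢ <;> grind
    · fin_cases j <;> fin_cases k <;>
        simp only [mixedDist, newDist, sup_le_iff, bot_le, Fin.reduceFinMk, Fin.zero_eta,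
          Fin.mk_one, Matrix.cons_val] at hc ⊢ <;> grind
    · fin_cases i <;> simp only [mixedDist, sup_le_iff, Fin.reduceFinMk, Fin.zero_eta,
        Fin.mk_one, Matrix.cons_val] at hc ⊢ <;> grind
    · fin_cases i <;> fin_cases k <;>
        simp only [mixedDist, newDist, sup_le_iff, bot_le, Fin.reduceFinMk, Fin.zero_eta,
          Fin.mk_one, Matrix.cons_val] at hc ⊢ <;> grind
    · fin_cases i <;> fin_cases j <;>
        simp only [mixedDist, newDist, sup_le_iff, bot_le, Fin.reduceFinMk, Fin.zero_eta,
          Fin.mk_one, Matrix.cons_val] at hc ⊢ <;> grind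
    · exact (newDist_triangle a b i j k).trans hc

/-- A pair at distance at most the value of a term `t` in `L` becomes related under the value of
`t` in the partition lattice, after finitely many points have been added. -/
theorem exists_isometry_eval_within (a : ℕ → L) (t : LatticeTerm) :
    ∀ {X : Type} [Finite X] (d : LatticeMetric L X) (p q : X), d.dist p q ≤ t.eval a →
      ∃ (Y : Type) (_ : Finite Y) (d' : LatticeMetric L Y) (f : X → Y),
        (∀ x y, d'.dist (f x) (f y) = d.dist x y) ∧
          t.eval (fun i => d'.within (a i)) (f p) (f q) := by
  induction t with
  | var i => exact fun {X} hX d p q h => ⟨X, hX, d, id, fun _ _ => rfl, h⟩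
  | meet s t hs ht =>
    intro X _ d p q h
    obtain ⟨Y, _, d₁, f, hf, hfs⟩ := hs d p q (h.trans inf_le_left)
    obtain ⟨Z, hZ, d₂, g, hg, hgt⟩ := ht d₁ (f p) (f q) ((hf p q).trans_le (h.trans inf_le_right))
    exact ⟨Z, hZ, d₂, g ∘ f, fun x y => (hg _ _).trans (hf x y),
      eval_within_of_isometry hg a s hfs, hgt⟩
  | join s t hs ht =>
    intro X _ d p q h
    -- Each of the four steps of the inserted path is treated by the induction hypothesis, in the
    -- extension produced by the preceding step; related pairs stay related in later extensions.
    set d₀ := d.jonsson p q (s.eval a) (t.eval a) h with hd₀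
    obtain ⟨Y₁, _, d₁, f₁, hf₁, h₁⟩ := hs d₀ (.inl p) (.inr 0) (by
      simp [hd₀, jonsson, mixedDist, d.dist_self])
    obtain ⟨Y₂, _, d₂, f₂, hf₂, h₂⟩ := ht d₁ (f₁ (.inr 0)) (f₁ (.inr 1)) (by
      simp [hf₁, hd₀, jonsson, newDist])
    obtain ⟨Y₃, _, d₃, f₃, hf₃, h₃⟩ := hs d₂ (f₂ (f₁ (.inr 1))) (f₂ (f₁ (.inr 2))) (by
      simp [hf₁, hf₂, hd₀, jonsson, newDist])
    obtain ⟨Y₄, hY₄, d₄, f₄, hf₄, h₄⟩ := ht d₃ (f₃ (f₂ (f₁ (.inr 2)))) (f₃ (f₂ (f₁ (.inl q)))) (by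
      simp [hf₁, hf₂, hf₃, hd₀, jonsson, mixedDist, d.dist_self])
    refine ⟨Y₄, hY₄, d₄, fun x => f₄ (f₃ (f₂ (f₁ (.inl x)))), fun x y => ?_, ?_⟩
    · rw [hf₄, hf₃, hf₂, hf₁]
      rfl
    · have hl : s.eval (fun i => d₄.within (a i)) ≤ (s.join t).eval fun i => d₄.within (a i) :=
        le_sup_left
      have hr : t.eval (fun i => d₄.within (a i)) ≤ (s.join t).eval fun i => d₄.within (a i) :=
        le_sup_right
      have e₁ := hl (eval_within_of_isometry hf₄ a s (eval_within_of_isometry hf₃ a s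
        (eval_within_of_isometry hf₂ a s h₁)))
      have e₂ := hr (eval_within_of_isometry hf₄ a t (eval_within_of_isometry hf₃ a t h₂))
      have e₃ := hl (eval_within_of_isometry hf₄ a s h₃)
      exact Setoid.trans' _ (Setoid.trans' _ (Setoid.trans' _ e₁ e₂) e₃) (hr h₄)

/-- The metric on two points at distance `c`. -/
def twoPoint (c : L) : LatticeMetric L Bool where
  dist x y := if x = y then ⊥ else c
  dist_self := by simp
  dist_comm x y := by simp only [eq_comm]
  dist_triangle := by rintro (_ | _) (_ | _) (_ | _) <;> simp

end LatticeMetric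

namespace LatticeTerm

/-- An inequality of lattice terms which holds in all partition lattices of finite sets holds in
all lattices. -/
theorem eval_le_of_forall_setoid {s t : LatticeTerm}
    (h : ∀ (X : Type) [Finite X] [Nonempty X] (b : ℕ → Setoid X), s.eval b ≤ t.eval b)
    {L : Type*} [Lattice L] (a : ℕ → L) : s.eval a ≤ t.eval a := by
  -- A bottom element is adjoined, to serve as the distance from a point to itself.
  let F : LatticeHom L (WithBot L) :=
    { toFun := (↑), map_sup' := fun _ _ => rfl, map_inf' := fun _ _ => rfl }
  have key : s.eval (fun i => F (a i)) ≤ t.eval (fun i => F (a i)) := by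
    obtain ⟨Y, _, d, f, hf, hs⟩ := LatticeMetric.exists_isometry_eval_within (fun i => F (a i)) s
      (LatticeMetric.twoPoint (s.eval fun i => F (a i))) false true le_rfl
    have : Nonempty Y := ⟨f true⟩
    have hle := d.eval_within_le (fun i => F (a i)) t (h Y _ hs)
    exact (hf false true).symm.trans_le hle
  rw [← map_eval, ← map_eval] at key
  exact WithBot.coe_le_coe.mp key

end LatticeTerm

namespace LatticeIdentity

/-- The duals of the partition lattices of finite sets satisfy no non-trivial lattice identity. -/
theorem IsNontrivial.exists_not_holdsIn_orderDual_setoid {e : LatticeIdentity}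
    (he : e.IsNontrivial.{v}) : ∃ n : ℕ, ¬ e.HoldsIn (Setoid (Fin (n + 1)))ᵒᵈ := by
  by_contra! hall
  have hfin : ∀ (X : Type) [Finite X] [Nonempty X] (b : ℕ → Setoid X),
      e.lhs.dual.eval b = e.rhs.dual.eval b := by
    intro X _ _ b
    obtain ⟨m, ⟨g⟩⟩ := Finite.exists_equiv_fin X
    obtain ⟨n, rfl⟩ : ∃ n, m = n + 1 := by
      refine Nat.exists_eq_succ_of_ne_zero ?_
      rintro rfl
      exact (g (Classical.arbitrary X)).elim0
    have hX : e.HoldsIn (Setoid X)ᵒᵈ :=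
      (hall n).of_surjective (Setoid.comapOrderIso g).dual.toLatticeHom
        (Setoid.comapOrderIso g).dual.surjective
    have hb := hX fun i => OrderDual.toDual (b i)
    rw [← LatticeTerm.dual_dual e.lhs, ← LatticeTerm.dual_dual e.rhs, LatticeTerm.eval_dual,
      LatticeTerm.eval_dual] at hb
    exact OrderDual.toDual.injective hb
  -- The dual identity is compared in `Lᵒᵈ`, which turns it back into `e` in `L`.
  obtain ⟨L, _, hL⟩ := he
  refine hL fun a => ?_
  have h₁ := LatticeTerm.eval_le_of_forall_setoid (fun X _ _ b => (hfin X b).le)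
    fun i => OrderDual.toDual (a i)
  have h₂ := LatticeTerm.eval_le_of_forall_setoid (fun X _ _ b => (hfin X b).ge)
    fun i => OrderDual.toDual (a i)
  rw [LatticeTerm.eval_dual, LatticeTerm.eval_dual] at h₁ h₂
  exact le_antisymm h₂ h₁

end LatticeIdentity

/-! ### Words and their commutative images -/

namespace MonVar

/-- Words that are rearrangements of each other have the same value in a commutative monoid. -/
theorem map_eq_of_perm {M : Type*} [Monoid M] (hM : ∀ a b : M, a * b = b * a) (f : Word →* M)
    {u v : Word} (h : u.toList.Perm v.toList) : f u = f v := by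
  let _ : CommMonoid M := { ‹Monoid M› with mul_comm := hM }
  rw [← FreeMonoid.lift_restrict f, FreeMonoid.lift_apply, FreeMonoid.lift_apply]
  exact (h.map _).prod_eq

/-- The abelianization of the free monoid: a word is sent to the multiset of its letters. -/
def letters : Word →* Multiplicative (Multiset ℕ) where
  toFun w := Multiplicative.ofAdd (w.toList : Multiset ℕ)
  map_one' := rfl
  map_mul' _ _ := rfl

theorem letters_eq_iff {u v : Word} : letters u = letters v ↔ u.toList.Perm v.toList :=
  Multiplicative.ofAdd.injective.eq_iff.trans Multiset.coe_eq_coe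

theorem perm_map (φ : Word →* Word) {u v : Word} (h : u.toList.Perm v.toList) :
    (φ u).toList.Perm (φ v).toList :=
  letters_eq_iff.mp (map_eq_of_perm mul_comm (letters.comp φ) h)

/-- The word `x ^ (n - i) y x ^ i`. -/
def wordA (n i : ℕ) : Word := FreeMonoid.of 0 ^ (n - i) * FreeMonoid.of 1 * FreeMonoid.of 0 ^ i

theorem toList_of_pow (a k : ℕ) : (FreeMonoid.of a ^ k).toList = List.replicate k a := by
  induction k with
  | zero => rfl
  | succ k ih => rw [pow_succ', FreeMonoid.toList_of_mul, ih, List.replicate_succ]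

theorem length_pow (w : Word) (k : ℕ) : (w ^ k).length = k * w.length := by
  induction k with
  | zero => simp
  | succ k ih => rw [pow_succ, FreeMonoid.length_mul, ih, Nat.succ_mul]

theorem toList_wordA (n i : ℕ) :
    (wordA n i).toList = List.replicate (n - i) 0 ++ 1 :: List.replicate i 0 := by
  simp [wordA, toList_of_pow]

/-- The set `wordsA n` consists of all words with the commutative image of `x ^ n y`. -/
theorem mem_wordsA_iff {n : ℕ} {w : Word} :
    w ∈ wordsA n ↔ w.toList.Perm (1 :: List.replicate n 0) := by
  constructor
  · rintro ⟨i, hi, rfl⟩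
    change (wordA n i).toList.Perm _
    rw [toList_wordA]
    refine List.perm_middle.trans (List.Perm.cons _ ?_)
    rw [← List.replicate_add, Nat.sub_add_cancel hi]
  · intro h
    obtain ⟨s, t, hst⟩ := List.append_of_mem (h.mem_iff.mpr List.mem_cons_self)
    rw [hst] at h
    have h' := List.perm_replicate.mp (List.perm_middle.symm.trans h).cons_inv
    obtain ⟨hlen, hs, ht⟩ := List.append_eq_replicate_iff.mp h'
    refine ⟨t.length, by omega, FreeMonoid.toList.injective ?_⟩
    change _ = (wordA n t.length).toList
    rw [toList_wordA, hst, ← ht, ← hlen, Nat.add_sub_cancel, ← hs]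

theorem mem_wordsA_iff_of_perm {n : ℕ} {u v : Word} (h : u.toList.Perm v.toList) :
    u ∈ wordsA n ↔ v ∈ wordsA n := by
  rw [mem_wordsA_iff, mem_wordsA_iff]
  exact ⟨h.symm.trans, h.trans⟩

theorem perm_of_mem_wordsA {n : ℕ} {u v : Word} (hu : u ∈ wordsA n) (hv : v ∈ wordsA n) :
    u.toList.Perm v.toList :=
  (mem_wordsA_iff.mp hu).trans (mem_wordsA_iff.mp hv).symm

theorem wordA_mem {n i : ℕ} (hi : i ≤ n) : wordA n i ∈ wordsA n := ⟨i, hi, rfl⟩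

/-- The set `wordsA n` has `n + 1` elements. -/
theorem nonempty_wordsA_equiv (n : ℕ) : Nonempty (wordsA n ≃ Fin (n + 1)) := by
  refine ⟨(Equiv.ofBijective (fun i : Fin (n + 1) =>
    (⟨wordA n i, wordA_mem (Nat.le_of_lt_succ i.2)⟩ : wordsA n)) ⟨fun i j hij => ?_, ?_⟩).symm⟩
  · have h := congrArg (fun w : wordsA n => w.1.toList.idxOf 1) hij
    simp [toList_wordA, List.idxOf_append] at h
    omega
  · rintro ⟨_, i, hi, rfl⟩
    exact ⟨⟨i, Nat.lt_succ_of_le hi⟩, rfl⟩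

theorem map_wordA (φ : Word →* Word) (n i : ℕ) :
    φ (wordA n i) = φ (.of 0) ^ (n - i) * φ (.of 1) * φ (.of 0) ^ i := by
  simp [wordA]

/-- If a substitution `φ` sends `wordA n i` to a factor of a word of `wordsA n`, then it does so in
a trivial way: either `φ` does not distinguish `wordA n i` from `wordA n j`, or the factor is the
whole word and `φ` renames letters. Renaming fixes both letters unless `n = 1`, where it may also
interchange them, and then it interchanges the two words `xy` and `yx`. -/
theorem factor_mem_wordsA_cases {n i j : ℕ} (hi : i ≤ n) (hj : j ≤ n) (φ : Word →* Word)
    {a b : Word} (h : a * φ (wordA n i) * b ∈ wordsA n) :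
    φ (wordA n i) = φ (wordA n j) ∨
      a = 1 ∧ b = 1 ∧
        (φ (wordA n i) = wordA n i ∧ φ (wordA n j) = wordA n j ∨
          φ (wordA n i) = wordA n j ∧ φ (wordA n j) = wordA n i) := by
  by_cases hij : i = j
  · exact Or.inl (hij ▸ rfl)
  by_cases hX : φ (.of 0) = 1
  · left
    simp [map_wordA, hX]
  by_cases hY : φ (.of 1) = 1
  · left
    simp only [map_wordA, hY, mul_one, ← pow_add, Nat.sub_add_cancel hi, Nat.sub_add_cancel hj]
  rcases Nat.eq_zero_or_pos n with rfl | hn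
  · left
    rw [Nat.le_zero.mp hi, Nat.le_zero.mp hj]
  have hlen : a.length + (n * (φ (.of 0)).length + (φ (.of 1)).length) + b.length = n + 1 := by
    have h' := (mem_wordsA_iff.mp h).length_eq
    rw [List.length_cons, List.length_replicate] at h'
    change (a * φ (wordA n i) * b).length = n + 1 at h'
    rw [map_wordA, FreeMonoid.length_mul, FreeMonoid.length_mul, FreeMonoid.length_mul,
      FreeMonoid.length_mul, length_pow, length_pow] at h'
    rw [← h', ← Nat.sub_add_cancel hi, Nat.add_sub_cancel]
    ring
  have hX' : 0 < (φ (.of 0)).length :=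
    Nat.pos_of_ne_zero fun h0 => hX (FreeMonoid.length_eq_zero.mp h0)
  have hY' : 0 < (φ (.of 1)).length :=
    Nat.pos_of_ne_zero fun h0 => hY (FreeMonoid.length_eq_zero.mp h0)
  -- The length `n + 1` leaves no room for anything but single letters and an empty context.
  have hX1 : (φ (.of 0)).length = 1 := by
    by_contra hne
    have : n * 2 ≤ n * (φ (.of 0)).length := Nat.mul_le_mul_left n (by omega)
    omega
  rw [hX1] at hlen
  obtain ⟨p, hp⟩ := FreeMonoid.length_eq_one.mp hX1
  obtain ⟨q, hq⟩ := FreeMonoid.length_eq_one.mp (show (φ (.of 1)).length = 1 by omega)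
  obtain rfl : a = 1 := FreeMonoid.length_eq_zero.mp (by omega)
  obtain rfl : b = 1 := FreeMonoid.length_eq_zero.mp (by omega)
  rw [one_mul, mul_one] at h
  -- The renamed word has the letters `q, p, …, p`, to be compared with `1, 0, …, 0`.
  have hperm : (q :: List.replicate n p).Perm (1 :: List.replicate n 0) := by
    refine List.Perm.trans ?_ (mem_wordsA_iff.mp h)
    rw [map_wordA, hp, hq, FreeMonoid.toList_mul, FreeMonoid.toList_mul, toList_of_pow,
      toList_of_pow, FreeMonoid.toList_of, List.append_assoc, List.singleton_append]
    refine List.Perm.trans (List.Perm.cons _ ?_) List.perm_middle.symm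
    rw [← List.replicate_add, Nat.sub_add_cancel hi]
  refine Or.inr ⟨rfl, rfl, ?_⟩
  rw [map_wordA, map_wordA, hp, hq]
  have hq1 := hperm.mem_iff (a := 1)
  have hq0 := hperm.mem_iff (a := 0)
  have hc := hperm.count_eq 1
  simp only [List.mem_cons, List.mem_replicate, true_or, iff_true] at hq1 hq0
  by_cases h1 : q = 1
  · subst h1
    obtain rfl : p = 0 := by grind
    exact Or.inl ⟨rfl, rfl⟩
  · obtain rfl : p = 1 := by grind
    obtain rfl : q = 0 := by grind
    obtain rfl : n = 1 := by simpa [List.count_cons, List.count_replicate] using hc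
    interval_cases i <;> interval_cases j <;> simp [wordA] at hij ⊢

end MonVar

/-! ### Identities of a variety as a congruence -/

namespace MonVar

/-- A congruence on words is fully invariant if it is preserved by all substitutions. -/
def FullyInvariant (c : Con Word) : Prop :=
  ∀ (φ : Word →* Word) ⦃u v : Word⦄, c u v → c (φ u) (φ v)

/-- The pairs of words that form identities of a class of monoids, as a congruence. -/
def identityCon (K : Set MonCat.{u}) : Con Word where
  r p q := (p, q) ∈ identitiesOf K
  iseqv :=
    { refl := fun _ _ _ _ => rfl
      symm := fun h M hM f => (h M hM f).symm
      trans := fun h₁ h₂ M hM f => (h₁ M hM f).trans (h₂ M hM f) }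
  mul' h₁ h₂ M hM f := by
    have e₁ := h₁ M hM f
    have e₂ := h₂ M hM f
    simp only [map_mul] at e₁ e₂ ⊢
    rw [e₁, e₂]

theorem identityCon_fullyInvariant (K : Set MonCat.{u}) : FullyInvariant (identityCon K) :=
  fun φ _ _ h M hM f => h M hM (f.comp φ)

/-- Completeness of equational logic: a fully invariant congruence that contains the identities `E`
contains all their consequences, since the quotient of the free monoid is a model of `E`. -/
theorem identityCon_models_le {E : Set MonoidIdentity} {c : Con Word} (hc : FullyInvariant c)
    (hE : ∀ p ∈ E, c p.1 p.2) : identityCon (models.{u} E) ≤ c := by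
  intro u v h
  let up : c.Quotient ≃* ULift.{u} c.Quotient := MulEquiv.ulift.symm
  have hmodel : MonCat.of (ULift.{u} c.Quotient) ∈ models.{u} E := by
    intro p hp f
    choose g hg using fun k : ℕ => c.mk'_surjective (up.symm (f (.of k)))
    have hf : f = up.toMonoidHom.comp (c.mk'.comp (FreeMonoid.lift g)) := by
      refine FreeMonoid.hom_eq fun k => ?_
      change _ = up (c.mk' (FreeMonoid.lift g (.of k)))
      rw [FreeMonoid.lift_eval_of, hg, MulEquiv.apply_symm_apply]
    rw [hf]
    exact congrArg up ((Con.eq c).mpr (hc (FreeMonoid.lift g) (hE p hp)))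
  exact (Con.eq c).mp (up.injective (h _ hmodel (up.toMonoidHom.comp c.mk')))

/-- The join of two congruences in the lattice of equivalence relations is a congruence. -/
def supCon (c d : Con Word) : Con Word where
  toSetoid := c.toSetoid ⊔ d.toSetoid
  mul' {w x y z} h₁ h₂ := by
    have hl : c.toSetoid ⊔ d.toSetoid ≤ Setoid.comap (x * ·) (c.toSetoid ⊔ d.toSetoid) :=
      sup_le (fun _ _ h => (le_sup_left : c.toSetoid ≤ _) (c.mul (c.refl x) h))
        (fun _ _ h => (le_sup_right : d.toSetoid ≤ _) (d.mul (d.refl x) h))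
    have hr : c.toSetoid ⊔ d.toSetoid ≤ Setoid.comap (· * y) (c.toSetoid ⊔ d.toSetoid) :=
      sup_le (fun _ _ h => (le_sup_left : c.toSetoid ≤ _) (c.mul h (c.refl y)))
        (fun _ _ h => (le_sup_right : d.toSetoid ≤ _) (d.mul h (d.refl y)))
    exact Setoid.trans' _ (hr h₁) (hl h₂)

theorem FullyInvariant.supCon {c d : Con Word} (hc : FullyInvariant c) (hd : FullyInvariant d) :
    FullyInvariant (supCon c d) := by
  intro φ
  have h : c.toSetoid ⊔ d.toSetoid ≤ Setoid.comap φ (c.toSetoid ⊔ d.toSetoid) :=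
    sup_le (fun _ _ h => (le_sup_left : c.toSetoid ≤ _) (hc φ h))
      (fun _ _ h => (le_sup_right : d.toSetoid ≤ _) (hd φ h))
  exact fun u v huv => h huv

theorem identityCon_anti {K K' : Set MonCat.{u}} (h : K ⊆ K') : identityCon K' ≤ identityCon K :=
  fun _ _ hp M hM => hp M (h hM)

end MonVar

namespace MonoidVariety

open MonVar

theorem toSetoid_identityCon_inf (V W : MonoidVariety.{u}) :
    (identityCon (V ⊓ W).1).toSetoid = (identityCon V.1).toSetoid ⊔ (identityCon W.1).toSetoid := by
  apply le_antisymm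
  · have h : identityCon (V ⊓ W).1 ≤ supCon (identityCon V.1) (identityCon W.1) := by
      change identityCon (V.1 ∩ W.1) ≤ _
      rw [inter_eq]
      refine identityCon_models_le
        ((identityCon_fullyInvariant _).supCon (identityCon_fullyInvariant _)) ?_
      rintro p (hp | hp)
      · exact (le_sup_left : (identityCon V.1).toSetoid ≤ _) hp
      · exact (le_sup_right : _ ≤ (identityCon V.1).toSetoid ⊔ (identityCon W.1).toSetoid) hp
    exact fun _ _ => @h _ _
  · exact sup_le (fun _ _ => @identityCon_anti _ _ Set.inter_subset_left _ _)
      (fun _ _ => @identityCon_anti _ _ Set.inter_subset_right _ _)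

theorem identityCon_sup (V W : MonoidVariety.{u}) {p q : Word} :
    identityCon (V ⊔ W).1 p q ↔ identityCon V.1 p q ∧ identityCon W.1 p q :=
  ⟨fun h => ⟨identityCon_anti (le_sup_left : V ≤ V ⊔ W) h,
      identityCon_anti (le_sup_right : W ≤ V ⊔ W) h⟩,
    fun h _ hM => hM (p, q) h⟩

/-- The words of an identity of an overcommutative variety are rearrangements of each other. -/
theorem IsOvercommutative.perm {V : MonoidVariety.{u}} (hV : V.IsOvercommutative) {p q : Word}
    (h : identityCon V.1 p q) : p.toList.Perm q.toList := by
  -- The free commutative monoid, lifted to the universe of the variety, belongs to `V`.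
  let up : Multiplicative (Multiset ℕ) ≃* ULift.{u} (Multiplicative (Multiset ℕ)) :=
    MulEquiv.ulift.symm
  have hM := hV (MonCat.of (ULift.{u} (Multiplicative (Multiset ℕ)))) fun a b =>
    mul_comm (G := ULift.{u} (Multiplicative (Multiset ℕ))) a b
  exact letters_eq_iff.mp (up.injective (h _ hM (up.toMonoidHom.comp letters)))

theorem isOvercommutative_ofIdentities {E : Set MonoidIdentity}
    (hE : ∀ p ∈ E, p.1.toList.Perm p.2.toList) : (ofIdentities.{u} E).IsOvercommutative :=
  fun _ hM p hp f => map_eq_of_perm hM f (hE p hp)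

end MonoidVariety

/-! ### Partitions of a set of words -/

namespace MonVar

/-- The extension of an equivalence relation on a set `A` of words to all words in which the
complement of `A` is one class. -/
def extendSetoid {A : Set Word} (r : Setoid A) : Setoid Word where
  r p q := (p ∈ A ↔ q ∈ A) ∧ ∀ (hp : p ∈ A) (hq : q ∈ A), r ⟨p, hp⟩ ⟨q, hq⟩
  iseqv :=
    { refl := fun _ => ⟨Iff.rfl, fun _ _ => r.refl' _⟩
      symm := fun h => ⟨h.1.symm, fun hp hq => r.symm' (h.2 hq hp)⟩
      trans := fun h₁ h₂ => ⟨h₁.1.trans h₂.1, fun hp hq =>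
        r.trans' (h₁.2 hp (h₁.1.mp hp)) (h₂.2 (h₁.1.mp hp) hq)⟩ }

/-- Restriction to a set which is a union of classes of both relations commutes with joins. -/
theorem comap_val_sup {A : Set Word} {c d : Setoid Word} (hc : ∀ ⦃p q⦄, c p q → (p ∈ A ↔ q ∈ A))
    (hd : ∀ ⦃p q⦄, d p q → (p ∈ A ↔ q ∈ A)) :
    Setoid.comap ((↑) : A → Word) (c ⊔ d) =
      Setoid.comap ((↑) : A → Word) c ⊔ Setoid.comap ((↑) : A → Word) d := by
  set r := Setoid.comap ((↑) : A → Word) c ⊔ Setoid.comap ((↑) : A → Word) d with hr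
  apply le_antisymm
  · have h : c ⊔ d ≤ extendSetoid r :=
      sup_le
        (fun p q h => ⟨hc h, fun hp hq =>
          (le_sup_left : Setoid.comap ((↑) : A → Word) c ≤ r) (x := ⟨p, hp⟩) (y := ⟨q, hq⟩) h⟩)
        (fun p q h => ⟨hd h, fun hp hq =>
          (le_sup_right : Setoid.comap ((↑) : A → Word) d ≤ r) (x := ⟨p, hp⟩) (y := ⟨q, hq⟩) h⟩)
    exact fun x y hxy => (h hxy).2 x.2 y.2
  · exact sup_le (fun _ _ h => (le_sup_left : c ≤ c ⊔ d) h)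
      (fun _ _ h => (le_sup_right : d ≤ c ⊔ d) h)

/-- The largest fully invariant congruence contained in an equivalence relation on words. -/
def invariantCon (s : Setoid Word) : Con Word where
  r p q := ∀ (a b : Word) (φ : Word →* Word), s (a * φ p * b) (a * φ q * b)
  iseqv :=
    { refl := fun _ _ _ _ => s.refl' _
      symm := fun h a b φ => s.symm' (h a b φ)
      trans := fun h₁ h₂ a b φ => s.trans' (h₁ a b φ) (h₂ a b φ) }
  mul' {w x y z} h₁ h₂ a b φ := by
    have e₁ := h₁ a (φ y * b) φ
    have e₂ := h₂ (a * φ x) b φ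
    simp only [map_mul, mul_assoc] at e₁ e₂ ⊢
    exact s.trans' e₁ e₂

theorem invariantCon_fullyInvariant (s : Setoid Word) : FullyInvariant (invariantCon s) :=
  fun φ _ _ h a b ψ => h a b (ψ.comp φ)

/-- The identities given by a partition of `wordsA n` have no further consequences between words
of `wordsA n`. -/
theorem invariantCon_extendSetoid {n : ℕ} (r : Setoid (wordsA n)) {p q : wordsA n} (h : r p q) :
    invariantCon (extendSetoid r) p q := by
  intro a b φ
  have hmem : a * φ p * b ∈ wordsA n ↔ a * φ q * b ∈ wordsA n :=
    mem_wordsA_iff_of_perm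
      (((perm_map φ (perm_of_mem_wordsA p.2 q.2)).append_left a.toList).append_right b.toList)
  obtain ⟨_, i, hi, rfl⟩ := p
  obtain ⟨_, j, hj, rfl⟩ := q
  refine ⟨hmem, fun hp hq => ?_⟩
  rcases factor_mem_wordsA_cases hi hj φ hp with he | ⟨rfl, rfl, ⟨h₁, h₂⟩ | ⟨h₁, h₂⟩⟩
  · have e : (⟨_, hp⟩ : wordsA n) = ⟨_, hq⟩ := Subtype.ext (congrArg (fun w => a * w * b) he)
    exact e ▸ r.refl' _
  · have e₁ : (⟨_, hp⟩ : wordsA n) = ⟨_, wordA_mem hi⟩ :=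
      Subtype.ext (((mul_one _).trans (one_mul _)).trans h₁)
    have e₂ : (⟨_, hq⟩ : wordsA n) = ⟨_, wordA_mem hj⟩ :=
      Subtype.ext (((mul_one _).trans (one_mul _)).trans h₂)
    rw [e₁, e₂]
    exact h
  · have e₁ : (⟨_, hp⟩ : wordsA n) = ⟨_, wordA_mem hj⟩ :=
      Subtype.ext (((mul_one _).trans (one_mul _)).trans h₁)
    have e₂ : (⟨_, hq⟩ : wordsA n) = ⟨_, wordA_mem hi⟩ :=
      Subtype.ext (((mul_one _).trans (one_mul _)).trans h₂)
    rw [e₁, e₂]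
    exact r.symm' h

end MonVar

namespace OC

open MonVar MonoidVariety

theorem mem_wordsA_iff_of_identityCon {V : MON.{u}} (hV : V.IsOvercommutative) {n : ℕ}
    ⦃p q : Word⦄ (h : identityCon V.1 p q) : p ∈ wordsA n ↔ q ∈ wordsA n :=
  mem_wordsA_iff_of_perm (hV.perm h)

/-- The lattice anti-homomorphism which sends an overcommutative variety to the partition of
`wordsA n` by its identities. -/
def partitionHom (n : ℕ) : LatticeHom OC.{u} (Setoid (wordsA n))ᵒᵈ where
  toFun V := OrderDual.toDual (Setoid.comap ((↑) : wordsA n → Word) (identityCon V.1.1).toSetoid)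
  map_sup' V W := by
    rw [← toDual_inf]
    congr 1
    ext p q
    exact identityCon_sup V.1 W.1
  map_inf' V W := by
    rw [← toDual_sup, ← comap_val_sup (mem_wordsA_iff_of_identityCon V.2)
      (mem_wordsA_iff_of_identityCon W.2), ← toSetoid_identityCon_inf]

theorem partitionHom_surjective (n : ℕ) : Function.Surjective (partitionHom.{u} n) := by
  intro s
  set r : Setoid (wordsA n) := OrderDual.ofDual s
  let E : Set MonoidIdentity := {p | ∃ u v : wordsA n, r u v ∧ p = (u.1, v.1)}
  have hE : (ofIdentities.{u} E).IsOvercommutative := by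
    refine isOvercommutative_ofIdentities ?_
    rintro _ ⟨u, v, -, rfl⟩
    exact perm_of_mem_wordsA u.2 v.2
  refine ⟨⟨ofIdentities E, hE⟩, congrArg OrderDual.toDual
    (Setoid.ext fun p q => ⟨fun h => ?_, fun h => ?_⟩)⟩
  · have hle : identityCon (models.{u} E) ≤ invariantCon (extendSetoid r) := by
      refine identityCon_models_le (invariantCon_fullyInvariant _) ?_
      rintro _ ⟨u, v, huv, rfl⟩
      exact invariantCon_extendSetoid r huv
    have hpq := hle h 1 1 (MonoidHom.id _)
    simp only [one_mul, mul_one, MonoidHom.id_apply] at hpq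
    exact hpq.2 p.2 q.2
  · exact fun M hM => hM _ ⟨p, q, h, rfl⟩

theorem not_holdsIn {e : LatticeIdentity} (he : e.IsNontrivial.{v}) : ¬ e.HoldsIn OC.{u} := by
  intro h
  obtain ⟨n, hn⟩ := he.exists_not_holdsIn_orderDual_setoid
  obtain ⟨g⟩ := nonempty_wordsA_equiv n
  have hA := h.of_surjective (partitionHom.{u} n) (partitionHom_surjective n)
  exact hn (hA.of_surjective (Setoid.comapOrderIso g.symm).dual.toLatticeHom
    (Setoid.comapOrderIso g.symm).dual.surjective)

end OC

theorem mainTheorem1 :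
    (∀ n : ℕ, ∃ (S : Sublattice OC.{u}) (f : LatticeHom S (Setoid (MonVar.wordsA n))ᵒᵈ),
      Function.Surjective f) ∧
    (∀ e : LatticeIdentity, e.IsNontrivial.{v} → ¬ e.HoldsIn OC.{u}) ∧
    (∀ e : LatticeIdentity, e.IsNontrivial.{v} → ¬ e.HoldsIn MON.{u}) := by
  -- All overcommutative varieties can be restricted to `wordsA n`, so `S` is the whole lattice.
  refine ⟨fun n => ⟨⊤, (OC.partitionHom n).comp (Sublattice.subtype ⊤), ?_⟩,
    fun e he => OC.not_holdsIn he, fun e he h => OC.not_holdsIn.{u, v} he ?_⟩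
  · exact (OC.partitionHom_surjective n).comp fun V => ⟨⟨V, trivial⟩, rfl⟩
  · exact h.of_injective OC.subtype Subtype.val_injective
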